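/- A family $(X_i,d_i)_{i\in I}$ of metric spaces \emph{embeds uniformly into Hilbert space} if there are a Hilbert space $\mathcal H$, maps $F_i:X_i\to\mathcal H$ $(i\in I)$ and two non-decreasing functions $\rho_-,\rho_+:[0,\infty)\to[0,\infty)$ with $\rho_\pm(t)\to\infty$ as $t\to\infty$ such that $$\rho_-(d_i(x,y))\le\|F_i(x)-F_i(y)\|\le\rho_+(d_i(x,y))\qquad\text{for all } i\in I \text{ and } x,y\in X_i .$$ For every $\omega\in\mathbb N$ let $\mathbb F_\omega$ be a free group of rank $\omega$ with a basis $B_\omega$, and let $\ell_\omega$ be the word length on $\mathbb F_\omega$ with respect to $B_\omega\cup B_\omega^{-1}$. For a normal subgroup $N$ of $\mathbb F_\omega$ equip $\mathbb F_\omega/N$ with the quotient length $\overline\ell_\omega(gN)=\min_{h\in N}\ell_\omega(gh)$ and the metric $d(x,y)=\overline\ell_\omega(x^{-1}y)$. \textbf{Proposition.} There are, for every $\omega\in\mathbb N$, subgroups $N_{(\omega,k)}$ $(k\in\mathbb N)$ of $\mathbb F_\omega$ such that (1) each $N_{(\omega,k)}$ is a characteristic subgroup of finite index in $\mathbb F_\omega$;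 (2) $\bigcap_k N_{(\omega,k)}=\{1\}$ for every $\omega$; (3) $N_{(\omega,k+1)}$ is contained in $N_{(\omega,k)}$ and is a characteristic subgroup of $N_{(\omega,k)}$, for all $\omega$ and $k$; (4) the family of metric spaces $\mathbb F_\omega/N_{(\omega,k)}$, indexed by all pairs $(\omega,k)$ with $k\ge\omega$, embeds uniformly into Hilbert space. -/

import Mathlib

open Filter
open scoped NNReal

universe u v

/-- The word length on `G` with respect to a generating set `S`: the least length of a product of
elements of `S` and their inverses that represents `g`. -/
noncomputable def wordLength {G : Type u} [Group G] (S : Set G) (g : G) : ℕ :=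
  sInf {n : ℕ | ∃ w : List G, (∀ a ∈ w, a ∈ S ∨ a⁻¹ ∈ S) ∧ w.prod = g ∧ w.length = n}

/-- The quotient length on `G ⧸ N` induced by a length function `l` on `G`: the infimum of `l` over
the coset `q`, that is, the infimum over `h ∈ N` of `l (g * h)` if `q` is the class of `g`. -/
noncomputable def quotientLength {G : Type u} [Group G] (l : G → ℝ≥0) (N : Subgroup G)
    (q : G ⧸ N) : ℝ≥0 :=
  sInf (l '' {g : G | (g : G ⧸ N) = q})

/-- The left-invariant distance on the group `G ⧸ N` given by the quotient length of `l`. -/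
noncomputable def quotientDist {G : Type u} [Group G] (l : G → ℝ≥0) (N : Subgroup G) [N.Normal]
    (x y : G ⧸ N) : ℝ≥0 :=
  quotientLength l N (x⁻¹ * y)

/-- A family of spaces `X i` with distance functions `d i` embeds uniformly (coarsely) into Hilbert
space: there are maps `F i` from `X i` to a Hilbert space and two control functions, proper
and nondecreasing, that serve all members of the family. -/
def UniformlyEmbedsIntoHilbert {ι : Type v} (X : ι → Type u) (d : ∀ i, X i → X i → ℝ≥0) : Prop :=
  ∃ (H : Type (max u v)) (_ : NormedAddCommGroup H) (_ : InnerProductSpace ℂ H)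
    (_ : CompleteSpace H) (F : ∀ i, X i → H) (ρ₁ ρ₂ : ℝ≥0 → ℝ≥0),
    Monotone ρ₁ ∧ Tendsto ρ₁ atTop atTop ∧ Monotone ρ₂ ∧ Tendsto ρ₂ atTop atTop ∧
    ∀ (i : ι) (x y : X i),
      ρ₁ (d i x y) ≤ nndist (F i x) (F i y) ∧ nndist (F i x) (F i y) ≤ ρ₂ (d i x y)

/-! ### Word length. -/

section WordLength

variable {G : Type u} [Group G] {S : Set G}

/-! Start from the whole group and repeatedly pass to the common kernel of all homomorphisms to
`ZMod 2`, giving `N k`. The Cayley graph of `G ⧸ N (k + 1)` is then the mod two homology cover of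
that of `G ⧸ N k`: the class of `g` is determined by the endpoint and the mod two chain of its path
downstairs (`mem_modTwoKernel_iff_chain`). Each edge downstairs defines a wall upstairs, and the
number of walls separating two points is the Hamming distance of their chains. This is a squared
Euclidean distance and never exceeds the word distance.

Conversely, the two distances agree at small scale. The support of the chain of `g` contains a path
`h` with the same endpoints, and the two chains differ by a cycle inside that support. If the
support has fewer edges than the girth, the cycle vanishes, so `h` is a representative no longer
than the wall distance (`exists_wordLength_le_hammingNorm`). The girth grows by at least one at each
stage (`lt_wordLength_of_mem_modTwoKernel`), which also makes the intersection trivial. Since `ω ≤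
k`, only finitely many finite quotients lie below any given scale, so one pair of control functions
serves all. -/

theorem wordLength_prod_le {w : List G} (hw : ∀ a ∈ w, a ∈ S ∨ a⁻¹ ∈ S) :
    wordLength S w.prod ≤ w.length :=
  Nat.sInf_le ⟨w, hw, rfl, rfl⟩

theorem wordLength_one : wordLength S (1 : G) = 0 :=
  Nat.le_zero.1 (wordLength_prod_le (S := S) (w := []) (by simp))

theorem exists_list_prod_eq (hS : Subgroup.closure S = ⊤) (g : G) :
    ∃ w : List G, (∀ a ∈ w, a ∈ S ∨ a⁻¹ ∈ S) ∧ w.prod = g := by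
  have hg : g ∈ Submonoid.closure (S ∪ S⁻¹) := by
    rw [← Subgroup.closure_toSubmonoid, hS]
    trivial
  exact Submonoid.exists_list_of_mem_closure hg

theorem exists_list_length_eq_wordLength (hS : Subgroup.closure S = ⊤) (g : G) :
    ∃ w : List G, (∀ a ∈ w, a ∈ S ∨ a⁻¹ ∈ S) ∧ w.prod = g ∧ w.length = wordLength S g := by
  obtain ⟨w, hw, hg⟩ := exists_list_prod_eq hS g
  exact Nat.sInf_mem (s := {n : ℕ | ∃ w : List G, (∀ a ∈ w, a ∈ S ∨ a⁻¹ ∈ S) ∧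
    w.prod = g ∧ w.length = n}) ⟨_, w, hw, hg, rfl⟩

theorem wordLength_letter_mul_le (hS : Subgroup.closure S = ⊤) {s : G} (hs : s ∈ S ∨ s⁻¹ ∈ S)
    (g : G) : wordLength S (s * g) ≤ wordLength S g + 1 := by
  obtain ⟨w, hw, rfl, hl⟩ := exists_list_length_eq_wordLength hS g
  rw [← hl, ← List.prod_cons, ← List.length_cons]
  exact wordLength_prod_le (by simpa using ⟨hs, hw⟩)

theorem wordLength_pos (hS : Subgroup.closure S = ⊤) {g : G} (hg : g ≠ 1) :
    0 < wordLength S g := by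
  obtain ⟨w, -, hw, hl⟩ := exists_list_length_eq_wordLength hS g
  rw [← hl, List.length_pos_iff]
  rintro rfl
  exact hg hw.symm

theorem FreeGroupBasis.closure_range_eq_top {ι : Type v} (b : FreeGroupBasis ι G) :
    Subgroup.closure (Set.range b) = ⊤ := by
  rw [← (Subgroup.map_equiv_top b.repr.symm), ← FreeGroup.closure_range_of ι,
    MonoidHom.map_closure, ← Set.range_comp]
  rfl

end WordLength

/-! ### Quotient length. -/

section QuotientLength

variable {G : Type u} [Group G]

theorem quotientLength_le {l : G → ℝ≥0} {N : Subgroup G} (g : G) :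
    quotientLength l N (g : G ⧸ N) ≤ l g :=
  csInf_le (OrderBot.bddBelow _) ⟨g, rfl, rfl⟩

theorem le_quotientLength {l : G → ℝ≥0} {N : Subgroup G} {q : G ⧸ N} {r : ℝ≥0}
    (h : ∀ g : G, (g : G ⧸ N) = q → r ≤ l g) : r ≤ quotientLength l N q := by
  refine le_csInf ⟨_, q.out, Quotient.out_eq q, rfl⟩ ?_
  rintro _ ⟨g, hg, rfl⟩
  exact h g hg

end QuotientLength

/-! ### The mod two kernel of a subgroup. -/

section ModTwo

variable {G : Type u} [Group G]

/-- The intersection of the kernels of all homomorphisms from `N` to the group of order two. -/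
def modTwoKernel (N : Subgroup G) : Subgroup G :=
  (⨅ f : N →* Multiplicative (ZMod 2), f.ker).map N.subtype

theorem mem_modTwoKernel {N : Subgroup G} {g : G} :
    g ∈ modTwoKernel N ↔
      ∃ h : g ∈ N, ∀ f : N →* Multiplicative (ZMod 2), f ⟨g, h⟩ = 1 := by
  simp [modTwoKernel, Subgroup.mem_iInf, MonoidHom.mem_ker]

theorem modTwoKernel_le (N : Subgroup G) : modTwoKernel N ≤ N :=
  fun _ h => (mem_modTwoKernel.1 h).1

theorem characteristic_modTwoKernel_subgroupOf (N : Subgroup G) :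
    ((modTwoKernel N).subgroupOf N).Characteristic := by
  rw [Subgroup.characteristic_iff_le_comap]
  intro φ n hn
  simp only [Subgroup.mem_subgroupOf, Subgroup.mem_comap, mem_modTwoKernel] at hn ⊢
  obtain ⟨h, hf⟩ := hn
  exact ⟨(φ n).2, fun f => hf (f.comp φ.toMonoidHom)⟩

end ModTwo

/-! ### A criterion for uniform embeddability. -/

section Embedding

theorem UniformlyEmbedsIntoHilbert.of_forall_exists {ι : Type v} {X : ι → Type u}
    {d : ∀ i, X i → X i → ℝ≥0} {H : Type (max u v)} [NormedAddCommGroup H]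
    [InnerProductSpace ℂ H] [CompleteSpace H] (F : ∀ i, X i → H) (ρ₂ : ℝ≥0 → ℝ≥0)
    (hmono : Monotone ρ₂) (htend : Tendsto ρ₂ atTop atTop)
    (hle : ∀ i x y, nndist (F i x) (F i y) ≤ ρ₂ (d i x y))
    (hlt : ∀ R : ℝ≥0, ∃ C : ℝ≥0, ∀ i x y, nndist (F i x) (F i y) < R → d i x y < C) :
    UniformlyEmbedsIntoHilbert X d := by
  -- The lower control is the least image distance over pairs at distance at least `t`. Inserting
  -- `t` matters when no such pair exists: the infimum of the empty set is `0`, which would spoil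
  -- divergence.
  let A : ℝ≥0 → Set ℝ≥0 := fun t =>
    insert t {r | ∃ i x y, t ≤ d i x y ∧ nndist (F i x) (F i y) = r}
  have hA : ∀ t, (A t).Nonempty := fun t => ⟨t, Set.mem_insert _ _⟩
  refine ⟨H, ‹_›, ‹_›, ‹_›, F, fun t => sInf (A t), ρ₂, ?_, ?_, hmono, htend, fun i x y =>
    ⟨csInf_le (OrderBot.bddBelow _) (Or.inr ⟨i, x, y, le_rfl, rfl⟩), hle i x y⟩⟩
  · intro s t hst
    refine le_csInf (hA t) ?_
    rintro r (rfl | ⟨i, x, y, h, rfl⟩)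
    · exact (csInf_le (OrderBot.bddBelow _) (Set.mem_insert _ _)).trans hst
    · exact csInf_le (OrderBot.bddBelow _) (Or.inr ⟨i, x, y, hst.trans h, rfl⟩)
  · refine tendsto_atTop.2 fun R => ?_
    obtain ⟨C, hC⟩ := hlt R
    filter_upwards [eventually_ge_atTop (max R C)] with t ht
    refine le_csInf (hA t) ?_
    rintro r (rfl | ⟨i, x, y, h, rfl⟩)
    · exact (le_max_left _ _).trans ht
    · by_contra! hlt
      exact ((hC i x y hlt).trans_le ((le_max_right _ _).trans (ht.trans h))).false

end Embedding

theorem ZMod.eq_one_of_ne_zero_two {a : ZMod 2} (h : a ≠ 0) : a = 1 := by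
  revert a
  decide

/-! ### Mod two chains of paths in the Cayley graph, and growth of the girth. -/

section Chain

variable {G : Type u} [Group G] {ι : Type v}

/-- The permutation action of `Q` on the multiplicatively written functions `Q × ι → ZMod 2`. -/
def translateAut (Q : Type u) [Group Q] (ι : Type v) :
    Q →* MulAut (Q × ι → Multiplicative (ZMod 2)) where
  toFun q :=
    { toFun := fun f e => f (q⁻¹ * e.1, e.2)
      invFun := fun f e => f (q * e.1, e.2)
      left_inv := fun f => by ext; simp
      right_inv := fun f => by ext; simp
      map_mul' := fun _ _ => rfl }
  map_one' := by ext; simp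
  map_mul' p q := by ext; simp [mul_assoc]

theorem FreeGroupBasis.induction_right {p : G → Prop} (b : FreeGroupBasis ι G) (one : p 1)
    (mul : ∀ g i, p g → p (g * b i)) (mul_inv : ∀ g i, p g → p (g * (b i)⁻¹)) (g : G) : p g := by
  have hg : g ∈ Subgroup.closure (Set.range b) := by simp [b.closure_range_eq_top]
  induction hg using Subgroup.closure_induction_right with
  | one => exact one
  | mul_right x y hx hy ih =>
    obtain ⟨i, rfl⟩ := hy
    exact mul _ _ ih
  | mul_inv_cancel x y hx hy ih =>
    obtain ⟨i, rfl⟩ := hy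
    exact mul_inv _ _ ih

variable [DecidableEq ι] (b : FreeGroupBasis ι G) (N : Subgroup G) [N.Normal]
  [DecidableEq (G ⧸ N)]

/-- The Magnus homomorphism modulo two of the quotient `G ⧸ N` of the free group `G`. -/
def magnusHom :
    G →* ((G ⧸ N) × ι → Multiplicative (ZMod 2)) ⋊[translateAut (G ⧸ N) ι] (G ⧸ N) :=
  b.lift fun i => ⟨fun e => Multiplicative.ofAdd ((Pi.single (1, i) 1 : (G ⧸ N) × ι → ZMod 2) e), (b i : G)⟩

/-- The chain modulo two that is traced out, in the Cayley graph of `G ⧸ N`, by the path that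
starts at `1` and is labelled by `g`. The edge from `q` to `q * b i` is indexed by `(q, i)`. -/
def chain (g : G) : (G ⧸ N) × ι → ZMod 2 :=
  fun e => ((magnusHom b N g).left e).toAdd

theorem magnusHom_basis (i : ι) : magnusHom b N (b i) =
    ⟨fun e => Multiplicative.ofAdd ((Pi.single (1, i) 1 : (G ⧸ N) × ι → ZMod 2) e), (b i : G)⟩ := by
  have h := congrFun (b.lift.symm_apply_apply fun i =>
    (⟨fun e => Multiplicative.ofAdd ((Pi.single (1, i) 1 : (G ⧸ N) × ι → ZMod 2) e), (b i : G)⟩ :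
    ((G ⧸ N) × ι → Multiplicative (ZMod 2)) ⋊[translateAut (G ⧸ N) ι] (G ⧸ N))) i
  exact h

theorem magnusHom_right (g : G) : (magnusHom b N g).right = g := by
  have : SemidirectProduct.rightHom.comp (magnusHom b N) = QuotientGroup.mk' N :=
    b.ext_hom _ _ fun i => by simp [magnusHom_basis]
  exact DFunLike.congr_fun this g

theorem chain_one : chain b N 1 = 0 := by
  ext e
  simp [chain]

theorem chain_mul (g h : G) (e : (G ⧸ N) × ι) :
    chain b N (g * h) e = chain b N g e + chain b N h ((g : G ⧸ N)⁻¹ * e.1, e.2) := by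
  simp only [chain]
  rw [map_mul, SemidirectProduct.mul_left, magnusHom_right]
  rfl

theorem chain_basis (i : ι) : chain b N (b i) = Pi.single (1, i) 1 := by
  ext e
  simp [chain, magnusHom_basis]

theorem chain_inv (g : G) (e : (G ⧸ N) × ι) :
    chain b N g⁻¹ e = chain b N g ((g : G ⧸ N) * e.1, e.2) := by
  have h := chain_mul b N g⁻¹ g e
  rw [inv_mul_cancel, chain_one, QuotientGroup.mk_inv, inv_inv] at h
  exact CharTwo.add_eq_zero.1 h.symm

theorem chain_basis_inv (i : ι) : chain b N (b i)⁻¹ = Pi.single ((b i : G ⧸ N)⁻¹, i) 1 := by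
  ext ⟨q, j⟩
  simp only [chain_inv, chain_basis, Pi.single_apply, Prod.mk.injEq, mul_eq_one_iff_eq_inv']

theorem chain_mul_of_mem (g : G) {n : G} (hn : n ∈ N) :
    chain b N (n * g) = chain b N n + chain b N g := by
  ext e
  simp [chain_mul, (QuotientGroup.eq_one_iff n).2 hn]

variable {b N}

theorem chain_mul_basis (g : G) (i : ι) :
    chain b N (g * b i) = chain b N g + Pi.single ((g : G ⧸ N), i) 1 := by
  ext ⟨q, j⟩
  simp only [Pi.add_apply, chain_mul, chain_basis, Pi.single_apply, Prod.mk.injEq,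
    inv_mul_eq_one, @eq_comm _ (g : G ⧸ N) q]

/-- Choose coset representatives `s` and let `A` record the values of `f` on the Schreier
generators. Then `Φ g` and the pairing of `A` with the chain of `g` both increase by `A (g, i)` when
`g` is multiplied by `b i`, so on `N` the value of `f` depends only on the chain. The term `Φ 1` is
needed because `s 1` need not be `1`. -/
theorem apply_eq_one_of_chain_eq_zero [Finite ι] [N.FiniteIndex]
    (f : N →* Multiplicative (ZMod 2)) {n : G} (hn : n ∈ N)
    (h : chain b N n = 0) : f ⟨n, hn⟩ = 1 := by
  let s : G ⧸ N → G := Quotient.out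
  have hs : ∀ q, (s q : G ⧸ N) = q := Quotient.out_eq
  have hmem : ∀ g h : G, (g : G ⧸ N) = h → g * h⁻¹ ∈ N := fun g h e => by
    rw [← QuotientGroup.eq_one_iff, QuotientGroup.mk_mul, e, QuotientGroup.mk_inv,
      mul_inv_cancel]
  let A : (G ⧸ N) × ι → ZMod 2 := fun e =>
    (f ⟨s e.1 * b e.2 * (s (e.1 * b e.2))⁻¹, hmem _ _ (by simp [hs])⟩).toAdd
  let Φ : G → ZMod 2 := fun g => (f ⟨g * (s g)⁻¹, hmem _ _ (by simp [hs])⟩).toAdd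
  have : Finite (G ⧸ N) := Subgroup.finite_quotient_of_finiteIndex
  cases nonempty_fintype (G ⧸ N)
  cases nonempty_fintype ι
  have hΦ : ∀ g i, Φ (g * b i) = Φ g + A (g, i) := fun g i => by
    simp only [Φ, A, ← toAdd_mul, ← map_mul]
    congr 2
    ext
    simp [mul_assoc]
  have key : ∀ g, Φ g = Φ 1 + ∑ e, A e * chain b N g e := by
    intro g
    have step : ∀ g i, ∑ e, A e * chain b N (g * b i) e =
        (∑ e, A e * chain b N g e) + A (g, i) := fun g i => by
      simp [chain_mul_basis, mul_add, Finset.sum_add_distrib, Pi.single_apply]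
    induction g using b.induction_right with
    | one => simp [chain_one]
    | mul g i ih => rw [hΦ, step, ih, add_assoc]
    | mul_inv g i ih =>
      have h1 := hΦ (g * (b i)⁻¹) i
      have h2 := step (g * (b i)⁻¹) i
      rw [inv_mul_cancel_right] at h1 h2
      rw [h1, h2, ← add_assoc] at ih
      exact add_right_cancel ih
  have hn1 := key n
  simp only [h, Pi.zero_apply, mul_zero, Finset.sum_const_zero, add_zero] at hn1
  have hmul : f ⟨n * (s n)⁻¹, hmem _ _ (by simp [hs])⟩ =
      f ⟨n, hn⟩ * f ⟨1 * (s (1 : G))⁻¹, hmem _ _ (by simp [hs])⟩ := by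
    rw [← map_mul]
    congr 1
    ext
    simp [(QuotientGroup.eq_one_iff n).2 hn]
  have hn2 : f ⟨n * (s n)⁻¹, hmem _ _ (by simp [hs])⟩ =
    f ⟨1 * (s (1 : G))⁻¹, hmem _ _ (by simp [hs])⟩ := hn1
  rw [hn2] at hmul
  exact right_eq_mul.1 hmul

theorem mem_modTwoKernel_iff_chain [Finite ι] [N.FiniteIndex] {g : G} :
    g ∈ modTwoKernel N ↔ g ∈ N ∧ chain b N g = 0 := by
  rw [mem_modTwoKernel]
  refine ⟨fun ⟨h, hf⟩ => ⟨h, ?_⟩, fun ⟨h, hc⟩ => ⟨h, fun f =>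
    apply_eq_one_of_chain_eq_zero f h hc⟩⟩
  ext e
  -- Since `N` acts trivially on the graph, each chain coordinate is itself a homomorphism on `N`.
  have := hf (MonoidHom.mk' (fun n => Multiplicative.ofAdd (chain b N n e)) fun m n => by
    rw [← ofAdd_add, Subgroup.coe_mul, chain_mul_of_mem b N _ m.2, Pi.add_apply])
  exact this

theorem finiteIndex_modTwoKernel [Finite ι] [N.FiniteIndex] (b : FreeGroupBasis ι G) :
    (modTwoKernel N).FiniteIndex := by
  have : Finite (G ⧸ N) := Subgroup.finite_quotient_of_finiteIndex
  have : Finite (((G ⧸ N) × ι → Multiplicative (ZMod 2)) ⋊[translateAut (G ⧸ N) ι] (G ⧸ N)) :=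
    Finite.of_equiv _ SemidirectProduct.equivProd.symm
  refine Subgroup.finiteIndex_of_le (H := (magnusHom b N).ker) fun g hg => ?_
  rw [MonoidHom.mem_ker] at hg
  refine (mem_modTwoKernel_iff_chain (b := b)).2 ⟨?_, ?_⟩
  · rw [← QuotientGroup.eq_one_iff, ← magnusHom_right b, hg]
    rfl
  · ext e
    simp [chain, hg]

theorem exists_chain_eq_single {s : G} (hs : s ∈ Set.range b ∨ s⁻¹ ∈ Set.range b) :
    ∃ e, chain b N s = Pi.single e 1 := by
  rcases hs with ⟨i, rfl⟩ | ⟨i, hi⟩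
  · exact ⟨_, chain_basis b N i⟩
  · rw [← inv_inv s, ← hi]
    exact ⟨_, chain_basis_inv b N i⟩

theorem exists_append_cons_of_chain_ne_zero {w : List G} :
    ∀ {e : (G ⧸ N) × ι}, chain b N w.prod e ≠ 0 →
      ∃ u t v, w = u ++ t :: v ∧ chain b N t ((u.prod : G ⧸ N)⁻¹ * e.1, e.2) ≠ 0 := by
  induction w with
  | nil => simp [chain_one]
  | cons s w ih =>
    intro e he
    by_cases hs : chain b N s e = 0
    · rw [List.prod_cons, chain_mul, hs, zero_add] at he
      obtain ⟨u, t, v, rfl, ht⟩ := ih he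
      refine ⟨s :: u, t, v, rfl, ?_⟩
      simpa [mul_assoc] using ht
    · exact ⟨[], s, w, rfl, by simpa using hs⟩

/-- Two letters cross the same edge, with `u` read in between. Crossing in the same direction closes
the loop `s * u`; crossing in opposite directions closes the loop `u`. -/
theorem mem_of_chain_ne_zero {s t u : G} (hs : s ∈ Set.range b ∨ s⁻¹ ∈ Set.range b)
    (ht : t ∈ Set.range b ∨ t⁻¹ ∈ Set.range b) {e : (G ⧸ N) × ι} (hse : chain b N s e ≠ 0)
    (hte : chain b N t (((s * u : G) : G ⧸ N)⁻¹ * e.1, e.2) ≠ 0) :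
    (s = t ∧ s * u ∈ N) ∨ (s * t = 1 ∧ u ∈ N) := by
  have key : ∀ {c : Prop} [Decidable c], (if c then (1 : ZMod 2) else 0) ≠ 0 → c := by
    intro c _ h
    by_contra hc
    simp [hc] at h
  obtain ⟨q, k⟩ := e
  rcases hs with ⟨i, rfl⟩ | ⟨i, hi⟩ <;> rcases ht with ⟨j, rfl⟩ | ⟨j, hj⟩
  · rw [chain_basis, Pi.single_apply] at hse hte
    have h1 := key hse
    have h2 := key hte
    simp only [Prod.mk.injEq] at h1 h2
    obtain ⟨rfl, rfl⟩ := h1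
    obtain ⟨h2, rfl⟩ := h2
    exact Or.inl ⟨rfl, (QuotientGroup.eq_one_iff _).1 (inv_eq_one.1 (mul_eq_right.1 h2))⟩
  · obtain rfl : t = (b j)⁻¹ := by rw [hj, inv_inv]
    rw [chain_basis, Pi.single_apply] at hse
    rw [chain_basis_inv, Pi.single_apply] at hte
    have h1 := key hse
    have h2 := key hte
    simp only [Prod.mk.injEq] at h1 h2
    obtain ⟨rfl, rfl⟩ := h1
    obtain ⟨h2, rfl⟩ := h2
    right
    refine ⟨by simp, ?_⟩
    rw [← QuotientGroup.eq_one_iff]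
    simpa using h2
  · obtain rfl : s = (b i)⁻¹ := by rw [hi, inv_inv]
    rw [chain_basis_inv, Pi.single_apply] at hse
    rw [chain_basis, Pi.single_apply] at hte
    have h1 := key hse
    have h2 := key hte
    simp only [Prod.mk.injEq] at h1 h2
    obtain ⟨rfl, rfl⟩ := h1
    obtain ⟨h2, rfl⟩ := h2
    right
    refine ⟨by simp, ?_⟩
    rw [← QuotientGroup.eq_one_iff]
    simpa using h2
  · obtain rfl : s = (b i)⁻¹ := by rw [hi, inv_inv]
    obtain rfl : t = (b j)⁻¹ := by rw [hj, inv_inv]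
    rw [chain_basis_inv, Pi.single_apply] at hse hte
    have h1 := key hse
    have h2 := key hte
    simp only [Prod.mk.injEq] at h1 h2
    obtain ⟨rfl, rfl⟩ := h1
    obtain ⟨h2, rfl⟩ := h2
    exact Or.inl ⟨rfl, (QuotientGroup.eq_one_iff _).1 (inv_eq_one.1 (mul_eq_right.1 h2))⟩

/-- In a shortest word for `n`, the first edge must be crossed again, because the chain vanishes mod
two. The loop between the two crossings lies in `N` and has length at most `m`, hence is trivial in
`G`; deleting it, together with any cancelling pair of letters, shortens the word. -/
theorem lt_wordLength_of_mem_modTwoKernel [Finite ι] [N.FiniteIndex] {m : ℕ}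
    (hN : ∀ n ∈ N, n ≠ 1 → m < wordLength (Set.range b) n) {n : G} (hn : n ∈ modTwoKernel N)
    (hn1 : n ≠ 1) : m + 1 < wordLength (Set.range b) n := by
  by_contra! hle
  obtain ⟨w, hw, rfl, hl⟩ := exists_list_length_eq_wordLength b.closure_range_eq_top n
  rw [← hl] at hle
  have h0 := ((mem_modTwoKernel_iff_chain (b := b)).1 hn).2
  cases w with
  | nil => exact hn1 rfl
  | cons s w =>
    obtain ⟨hs, hw⟩ := List.forall_mem_cons.1 hw
    obtain ⟨e, he⟩ := exists_chain_eq_single (N := N) hs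
    have hse : chain b N s e ≠ 0 := by simp [he]
    have h0e := congrFun h0 e
    rw [List.prod_cons, chain_mul, Pi.zero_apply, CharTwo.add_eq_zero] at h0e
    rw [h0e] at hse
    obtain ⟨u, t, v, rfl, ht⟩ := exists_append_cons_of_chain_ne_zero hse
    rw [← h0e] at hse
    rw [List.forall_mem_append, List.forall_mem_cons] at hw
    obtain ⟨hu, htl, hv⟩ := hw
    have hte : chain b N t (((s * u.prod : G) : G ⧸ N)⁻¹ * e.1, e.2) ≠ 0 := by
      simpa [mul_assoc] using ht
    simp only [List.length_cons, List.length_append] at hle hl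
    rcases mem_of_chain_ne_zero hs htl hse hte with ⟨rfl, h⟩ | ⟨hst, h⟩
    · have h1 : s * u.prod = 1 := by
        by_contra hne
        have h2 := hN _ h hne
        have h3 := wordLength_prod_le (S := Set.range b) (w := s :: u)
          (List.forall_mem_cons.2 ⟨hs, hu⟩)
        simp only [List.prod_cons, List.length_cons] at h3
        omega
      have h4 := wordLength_prod_le (S := Set.range b) (w := s :: v)
        (List.forall_mem_cons.2 ⟨hs, hv⟩)
      have h5 : (s :: (u ++ s :: v)).prod = (s :: v).prod := by
        simp [← mul_assoc, h1]
      rw [h5] at hl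
      simp only [List.length_cons] at h4
      omega
    · have h1 : u.prod = 1 := by
        by_contra hne
        have h2 := hN _ h hne
        have h3 := wordLength_prod_le hu
        omega
      have h4 := wordLength_prod_le hv
      have h5 : (s :: (u ++ t :: v)).prod = v.prod := by
        simp [← mul_assoc, h1, hst]
      rw [h5] at hl
      omega

end Chain

theorem hammingNorm_add_single {α : Type v} [Fintype α] [DecidableEq α] {T : α → ZMod 2}
    {e : α} (he : T e ≠ 0) :
    hammingNorm (T + Pi.single e 1 : α → ZMod 2) + 1 = hammingNorm T := by
  have : (Finset.univ.filter fun f => (T + Pi.single e 1 : α → ZMod 2) f ≠ 0) =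
      (Finset.univ.filter fun f => T f ≠ 0).erase e := by
    ext f
    by_cases hf : f = e
    · subst hf
      simp [ZMod.eq_one_of_ne_zero_two he, CharTwo.add_self_eq_zero]
    · simp [hf]
  unfold hammingNorm
  rw [this, Finset.card_erase_add_one]
  simpa using he

/-! ### Translation and boundary of chains. -/

section ChainTranslate

variable {G : Type u} [Group G] {ι : Type v} {N : Subgroup G} [N.Normal]

/-- The translate of a chain in the Cayley graph of `G ⧸ N`. -/
def chainTranslate (q : G ⧸ N) (T : (G ⧸ N) × ι → ZMod 2) : (G ⧸ N) × ι → ZMod 2 :=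
  fun e => T (q⁻¹ * e.1, e.2)

theorem chainTranslate_mul (p q : G ⧸ N) (T : (G ⧸ N) × ι → ZMod 2) :
    chainTranslate (p * q) T = chainTranslate p (chainTranslate q T) := by
  ext e
  simp [chainTranslate, mul_assoc]

theorem chainTranslate_add (q : G ⧸ N) (S T : (G ⧸ N) × ι → ZMod 2) :
    chainTranslate q (S + T) = chainTranslate q S + chainTranslate q T :=
  rfl

variable [Fintype ι] (b : FreeGroupBasis ι G)

/-- The boundary modulo two of a chain in the Cayley graph of `G ⧸ N`. -/
def chainBoundary (T : (G ⧸ N) × ι → ZMod 2) (q : G ⧸ N) : ZMod 2 :=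
  ∑ i, T (q, i) + ∑ i, T (q * (b i : G ⧸ N)⁻¹, i)

theorem chainBoundary_add (S T : (G ⧸ N) × ι → ZMod 2) :
    chainBoundary b (S + T) = chainBoundary b S + chainBoundary b T := by
  ext q
  simp only [chainBoundary, Pi.add_apply, Finset.sum_add_distrib]
  ring

theorem chainBoundary_translate (q : G ⧸ N) (T : (G ⧸ N) × ι → ZMod 2) (p : G ⧸ N) :
    chainBoundary b (chainTranslate q T) p = chainBoundary b T (q⁻¹ * p) := by
  simp [chainBoundary, chainTranslate, mul_assoc]

end ChainTranslate

/-! ### Paths inside supports, and short cycles. -/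

section Boundary

variable {G : Type u} [Group G] {ι : Type v} [DecidableEq ι] {b : FreeGroupBasis ι G}
  {N : Subgroup G} [N.Normal] [DecidableEq (G ⧸ N)]

theorem chain_mul_eq_translate (g h : G) :
    chain b N (g * h) = chain b N g + chainTranslate (g : G ⧸ N) (chain b N h) :=
  funext fun e => chain_mul b N g h e

theorem chainTranslate_single (q p : G ⧸ N) (i : ι) :
    chainTranslate q (Pi.single (p, i) 1) = Pi.single (q * p, i) 1 := by
  ext e
  simp [chainTranslate, Pi.single_apply, Prod.ext_iff, inv_mul_eq_iff_eq_mul]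

variable [Fintype ι]

theorem hammingNorm_chain_le [Fintype (G ⧸ N)] (g : G) :
    hammingNorm (chain b N g) ≤ wordLength (Set.range b) g := by
  obtain ⟨w, hw, rfl, hl⟩ := exists_list_length_eq_wordLength b.closure_range_eq_top g
  rw [← hl]
  clear hl
  induction w with
  | nil => simp [chain_one]
  | cons s w ih =>
    obtain ⟨hs, hw⟩ := List.forall_mem_cons.1 hw
    obtain ⟨e, he⟩ := exists_chain_eq_single (N := N) hs
    have hsub : (Finset.univ.filter fun f => chain b N (s :: w).prod f ≠ 0) ⊆
        insert e ((Finset.univ.filter fun f => chain b N w.prod f ≠ 0).image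
          fun f => ((s : G ⧸ N) * f.1, f.2)) := by
      intro f hf
      rw [Finset.mem_filter, List.prod_cons, chain_mul, he] at hf
      rw [Finset.mem_insert, or_iff_not_imp_left]
      intro hfe
      rw [Pi.single_eq_of_ne hfe, zero_add] at hf
      exact Finset.mem_image.2 ⟨_, Finset.mem_filter.2 ⟨Finset.mem_univ _, hf.2⟩, by simp⟩
    calc _ ≤ _ := Finset.card_le_card hsub
      _ ≤ _ := Finset.card_insert_le _ _
      _ ≤ _ := Nat.add_le_add_right (Finset.card_image_le.trans (ih hw)) 1

/-- Translating by `g` carries the chain of `g⁻¹ * h` to the difference of the two chains. -/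
theorem hammingDist_chain (g h : G) [Fintype (G ⧸ N)] :
    hammingDist (chain b N g) (chain b N h) = hammingNorm (chain b N (g⁻¹ * h)) := by
  have : ∀ e, chain b N (g⁻¹ * h) e =
      (chain b N g - chain b N h) ((g : G ⧸ N) * e.1, e.2) := fun e => by
    simp [chain_mul, chain_inv, CharTwo.sub_eq_add]
  rw [hammingDist_eq_hammingNorm]
  refine Finset.card_bij (fun e _ => ((g : G ⧸ N)⁻¹ * e.1, e.2)) ?_ ?_ ?_
  · intro e he
    rw [Finset.mem_filter] at he ⊢
    rw [this]
    simpa [CharTwo.sub_eq_add] using he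
  · rintro ⟨p, i⟩ - ⟨q, j⟩ - h
    simpa using h
  · intro e he
    refine ⟨((g : G ⧸ N) * e.1, e.2), ?_, by simp⟩
    rw [Finset.mem_filter, this] at he
    rw [Finset.mem_filter]
    simpa [CharTwo.sub_eq_add] using he

theorem chainBoundary_single (q : G ⧸ N) (i : ι) :
    chainBoundary b (Pi.single (q, i) 1) = Pi.single q 1 + Pi.single (q * b i) 1 := by
  ext p
  simp only [chainBoundary, Pi.single_apply, Prod.mk.injEq, Pi.add_apply, ite_and,
    mul_inv_eq_iff_eq_mul]
  have : ∀ (c : ι → Prop) [DecidablePred c],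
      (∑ j, if c j then if j = i then (1 : ZMod 2) else 0 else 0) = if c i then 1 else 0 := by
    intro c _
    rw [Finset.sum_eq_single i] <;> simp +contextual
  rw [this fun _ => p = q, this fun j => p = q * b j]

theorem chainBoundary_chain (g : G) :
    chainBoundary b (chain b N g) = Pi.single 1 1 + Pi.single (g : G ⧸ N) 1 := by
  have step : ∀ (g : G) i, chainBoundary b (chain b N (g * b i)) =
      chainBoundary b (chain b N g) +
        (Pi.single (g : G ⧸ N) 1 + Pi.single ((g * b i : G) : G ⧸ N) 1) := fun g i => by
    rw [chain_mul_basis, chainBoundary_add b, chainBoundary_single, QuotientGroup.mk_mul]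
  have two : ∀ f : G ⧸ N → ZMod 2, f + f = 0 := fun f => by
    ext
    exact CharTwo.add_self_eq_zero _
  induction g using b.induction_right with
  | one =>
    rw [chain_one, QuotientGroup.mk_one, two]
    ext
    simp [chainBoundary]
  | mul g i ih =>
    rw [step, ih, add_assoc, ← add_assoc (Pi.single (g : G ⧸ N) 1), two, zero_add]
  | mul_inv g i ih =>
    have h := step (g * (b i)⁻¹) i
    rw [inv_mul_cancel_right, ih, add_comm (Pi.single ((g * (b i)⁻¹ : G) : G ⧸ N) 1),
      ← add_assoc, add_comm (chainBoundary _ _), add_comm (Pi.single 1 1), add_assoc] at h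
    have h := add_left_cancel h
    rw [h, add_assoc, two, add_zero]

/-- A vertex in the boundary of `T` meets an edge of `T`; `s` is the letter that crosses this edge
starting from `q`. -/
theorem exists_translate_chain_eq_single {T : (G ⧸ N) × ι → ZMod 2} {q : G ⧸ N}
    (h : chainBoundary b T q ≠ 0) :
    ∃ s e, (s ∈ Set.range b ∨ s⁻¹ ∈ Set.range b) ∧ T e ≠ 0 ∧
      chainTranslate q (chain b N s) = Pi.single e 1 := by
  have h : ∑ i, T (q, i) ≠ 0 ∨ ∑ i, T (q * (b i : G ⧸ N)⁻¹, i) ≠ 0 := by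
    by_contra! h'
    exact h (by rw [chainBoundary, h'.1, h'.2, add_zero])
  rcases h with h | h
  · obtain ⟨i, -, hi⟩ := Finset.exists_ne_zero_of_sum_ne_zero h
    exact ⟨b i, _, Or.inl ⟨i, rfl⟩, hi, by simp [chain_basis, chainTranslate_single]⟩
  · obtain ⟨i, -, hi⟩ := Finset.exists_ne_zero_of_sum_ne_zero h
    exact ⟨(b i)⁻¹, _, Or.inr ⟨i, by simp⟩, hi, by
      simp [chain_basis_inv, chainTranslate_single]⟩

/-- Leave `p` along an edge of `T`, delete that edge and continue from its other end. No edge is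
used twice, which bounds the length. -/
theorem exists_chain_support_subset [Fintype (G ⧸ N)] {T : (G ⧸ N) × ι → ZMod 2}
    {p q : G ⧸ N} (hT : chainBoundary b T = Pi.single p 1 + Pi.single q 1) :
    ∃ g : G, p * g = q ∧ wordLength (Set.range b) g ≤ hammingNorm T ∧
      ∀ e, chainTranslate p (chain b N g) e ≠ 0 → T e ≠ 0 := by
  induction hn : hammingNorm T generalizing T p with
  | zero =>
    obtain rfl := hammingNorm_eq_zero.1 hn
    have h := congrFun hT p
    by_cases hpq : p = q
    · exact ⟨1, by simpa, by simp [wordLength_one], by simp [chain_one, chainTranslate]⟩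
    · simp [chainBoundary, hpq] at h
  | succ n ih =>
    by_cases hpq : p = q
    · exact ⟨1, by simpa, by simp [wordLength_one], by simp [chain_one, chainTranslate]⟩
    · have hp : chainBoundary b T p ≠ 0 := by simp [hT, hpq]
      obtain ⟨s, e, hs, he, hse⟩ := exists_translate_chain_eq_single hp
      have hT' : chainBoundary b (T + Pi.single e 1) =
          Pi.single (p * s) 1 + Pi.single q 1 := by
        rw [chainBoundary_add b, hT, ← hse]
        ext r
        rw [Pi.add_apply, chainBoundary_translate, chainBoundary_chain]
        have h1 : p⁻¹ * r = 1 ↔ r = p := by rw [inv_mul_eq_one, eq_comm]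
        have h2 : p⁻¹ * r = s ↔ r = p * s := inv_mul_eq_iff_eq_mul
        simp only [Pi.add_apply, Pi.single_apply, h1, h2]
        linear_combination CharTwo.add_self_eq_zero (if r = p then (1 : ZMod 2) else 0)
      have hn' : hammingNorm (T + Pi.single e 1) = n := by
        have := hammingNorm_add_single he
        omega
      obtain ⟨g, hg, hgl, hgT⟩ := ih hT' hn'
      refine ⟨s * g, by rw [QuotientGroup.mk_mul, ← mul_assoc, hg],
        (wordLength_letter_mul_le b.closure_range_eq_top hs g).trans
          (Nat.add_le_add_right hgl 1), fun f hf => ?_⟩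
      by_cases hfe : f = e
      · rwa [hfe]
      · rw [chain_mul_eq_translate, chainTranslate_add, hse, ← chainTranslate_mul, Pi.add_apply,
          Pi.single_eq_of_ne hfe, zero_add] at hf
        simpa [hfe] using hgT f hf

/-- Removing an edge from a nonzero cycle leaves a path joining its ends. Together with the edge
this is a loop of length at most `m`, so the path is the edge itself, which was removed. -/
theorem eq_zero_of_chainBoundary_eq_zero [Fintype (G ⧸ N)] {m : ℕ}
    (hN : ∀ n ∈ N, n ≠ 1 → m < wordLength (Set.range b) n) {T : (G ⧸ N) × ι → ZMod 2}
    (hT : chainBoundary b T = 0) (hm : hammingNorm T ≤ m) : T = 0 := by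
  by_contra h0
  obtain ⟨⟨q, i⟩, hi⟩ := Function.ne_iff.1 h0
  obtain ⟨g, hg, hgl, hgT⟩ := exists_chain_support_subset (T := T + Pi.single (q, i) 1)
    (p := q) (q := q * b i) (b := b) (by
      rw [chainBoundary_add b, hT, zero_add, chainBoundary_single])
  have hcard := hammingNorm_add_single hi
  have hn : (b i)⁻¹ * g ∈ N := by
    rw [← QuotientGroup.eq]
    exact (mul_left_cancel hg).symm
  have h1 : (b i)⁻¹ * g = 1 := by
    by_contra hne
    have h2 := hN _ hn hne
    have h3 := wordLength_letter_mul_le b.closure_range_eq_top (S := Set.range b)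
      (s := (b i)⁻¹) (Or.inr ⟨i, by simp⟩) g
    omega
  obtain rfl : b i = g := inv_mul_eq_one.1 h1
  refine hgT (q, i) (by simp [chain_basis, chainTranslate_single]) ?_
  rw [Pi.add_apply, Pi.single_eq_same, ZMod.eq_one_of_ne_zero_two hi]
  exact CharTwo.add_self_eq_zero _

theorem exists_wordLength_le_hammingNorm [Fintype (G ⧸ N)] {m : ℕ}
    (hN : ∀ n ∈ N, n ≠ 1 → m < wordLength (Set.range b) n) {g : G}
    (hm : hammingNorm (chain b N g) ≤ m) :
    ∃ h, g⁻¹ * h ∈ modTwoKernel N ∧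
      wordLength (Set.range b) h ≤ hammingNorm (chain b N g) := by
  have : N.FiniteIndex := Subgroup.finiteIndex_of_finite_quotient
  obtain ⟨h, hh, hl, hsub⟩ := exists_chain_support_subset (chainBoundary_chain (b := b) (N := N) g)
  rw [one_mul] at hh
  have hsub' : ∀ e, chain b N h e ≠ 0 → chain b N g e ≠ 0 := fun e he =>
    hsub e (by simpa [chainTranslate] using he)
  refine ⟨h, ?_, hl⟩
  have h0 : chain b N g + chain b N h = 0 := by
    refine eq_zero_of_chainBoundary_eq_zero hN ?_ (le_trans ?_ hm)
    · rw [chainBoundary_add b, chainBoundary_chain, chainBoundary_chain, hh]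
      ext q
      exact CharTwo.add_self_eq_zero
        ((Pi.single 1 1 + Pi.single (g : G ⧸ N) 1 : G ⧸ N → ZMod 2) q)
    · refine Finset.card_le_card fun e => ?_
      simp only [Finset.mem_filter, Finset.mem_univ, true_and]
      intro he hg
      exact he (by simp [hg, not_imp_not.1 (hsub' e) hg])
  rw [mem_modTwoKernel_iff_chain (b := b)]
  refine ⟨QuotientGroup.eq.1 hh.symm, ?_⟩
  rw [← hammingNorm_eq_zero, ← hammingDist_chain, hammingDist_eq_zero]
  ext e
  exact CharTwo.add_eq_zero.1 (congrFun h0 e)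

end Boundary

/-! ### The Euclidean wall map. -/

section WallMap

variable {G : Type u} [Group G] {ι : Type v} [DecidableEq ι] [Fintype ι]
  (b : FreeGroupBasis ι G) (N : Subgroup G) [N.Normal] [DecidableEq (G ⧸ N)] [Fintype (G ⧸ N)]

/-- The map to a Euclidean space that belongs to the walls of the cover of the Cayley graph of
`G ⧸ N` by the Cayley graph of `G ⧸ modTwoKernel N`. -/
noncomputable def wallMap (g : G) : EuclideanSpace ℂ ((G ⧸ N) × ι) :=
  WithLp.toLp 2 fun e => if chain b N g e = 0 then 0 else 1

theorem nndist_wallMap (g h : G) : nndist (wallMap b N g) (wallMap b N h) =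
    NNReal.sqrt (hammingDist (chain b N g) (chain b N h)) := by
  rw [EuclideanSpace.nndist_eq]
  congr 1
  rw [hammingDist, Finset.card_eq_sum_ones, Nat.cast_sum, Finset.sum_filter]
  refine Finset.sum_congr rfl fun e _ => ?_
  by_cases hg : chain b N g e = 0 <;> by_cases hh : chain b N h e = 0
  · simp [wallMap, hg, hh]
  · simp [wallMap, hg, hh, nndist_eq_nnnorm, Ne.symm hh]
  · simp [wallMap, hg, hh, nndist_eq_nnnorm]
  · simp [wallMap, ZMod.eq_one_of_ne_zero_two hg, ZMod.eq_one_of_ne_zero_two hh]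

variable {b N} [(modTwoKernel N).Normal]

/-- All representatives of `x⁻¹ * y` have the same chain, and a path crosses at most as many edges
as its length. -/
theorem hammingDist_chain_out_le (x y : G ⧸ modTwoKernel N) :
    (hammingDist (chain b N x.out) (chain b N y.out) : ℝ≥0) ≤
      quotientDist (fun g => (wordLength (Set.range b) g : ℝ≥0)) (modTwoKernel N) x y := by
  have : N.FiniteIndex := Subgroup.finiteIndex_of_finite_quotient
  refine le_quotientLength fun g hg => Nat.cast_le.2 ?_
  have hmem : g⁻¹ * (x.out⁻¹ * y.out) ∈ modTwoKernel N := by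
    rw [← QuotientGroup.eq, hg, QuotientGroup.mk_mul, QuotientGroup.mk_inv]
    simp
  have hc := (mem_modTwoKernel_iff_chain (b := b)).1 hmem
  have hgc : chain b N g = chain b N (x.out⁻¹ * y.out) := by
    rw [← hammingDist_eq_zero, hammingDist_chain, hc.2, hammingNorm_zero]
  rw [hammingDist_chain, ← hgc]
  exact hammingNorm_chain_le g

theorem quotientDist_le_hammingDist {m : ℕ}
    (hN : ∀ n ∈ N, n ≠ 1 → m < wordLength (Set.range b) n) {x y : G ⧸ modTwoKernel N}
    (hm : hammingDist (chain b N x.out) (chain b N y.out) ≤ m) :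
    quotientDist (fun g => (wordLength (Set.range b) g : ℝ≥0)) (modTwoKernel N) x y ≤
      hammingDist (chain b N x.out) (chain b N y.out) := by
  rw [hammingDist_chain] at hm ⊢
  obtain ⟨h, hmem, hl⟩ := exists_wordLength_le_hammingNorm hN hm
  have hxy : x⁻¹ * y = (h : G ⧸ modTwoKernel N) := by
    rw [← QuotientGroup.eq.2 hmem, QuotientGroup.mk_mul, QuotientGroup.mk_inv]
    simp
  rw [quotientDist, hxy]
  exact (quotientLength_le h).trans (Nat.cast_le.2 hl)

end WallMap

/-! ### The iterated series. -/

section Series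

variable {G : Type u} [Group G] {ι : Type v}

variable (G) in
/-- The series of iterated mod two kernels. -/
def modTwoSeries : ℕ → Subgroup G
  | 0 => ⊤
  | k + 1 => modTwoKernel (modTwoSeries k)

instance modTwoKernel_characteristic (N : Subgroup G) [N.Characteristic] :
    (modTwoKernel N).Characteristic := by
  have h := characteristic_modTwoKernel_subgroupOf N
  have : ((modTwoKernel N).subgroupOf N).map N.subtype = modTwoKernel N :=
    Subgroup.map_subgroupOf_eq_of_le (modTwoKernel_le N)
  exact this ▸ inferInstance

instance modTwoSeries_characteristic (k : ℕ) : (modTwoSeries G k).Characteristic := by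
  induction k with
  | zero => exact Subgroup.topCharacteristic
  | succ k ih => exact modTwoKernel_characteristic _

theorem finiteIndex_modTwoSeries [Finite ι] (b : FreeGroupBasis ι G) (k : ℕ) :
    (modTwoSeries G k).FiniteIndex := by
  classical
  induction k with
  | zero => exact inferInstanceAs (⊤ : Subgroup G).FiniteIndex
  | succ k ih => exact finiteIndex_modTwoKernel b

theorem lt_wordLength_of_mem_modTwoSeries [Finite ι] (b : FreeGroupBasis ι G) (k : ℕ) :
    ∀ n ∈ modTwoSeries G k, n ≠ 1 → k < wordLength (Set.range b) n := by
  classical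
  induction k with
  | zero => exact fun n _ hn => wordLength_pos b.closure_range_eq_top hn
  | succ k ih =>
    have := finiteIndex_modTwoSeries b k
    exact fun n hn hn1 => lt_wordLength_of_mem_modTwoKernel ih hn hn1

theorem iInf_modTwoSeries [Finite ι] (b : FreeGroupBasis ι G) :
    ⨅ k, modTwoSeries G k = ⊥ := by
  refine (Subgroup.eq_bot_iff_forall _).2 fun n hn => ?_
  by_contra hne
  exact lt_irrefl _ (lt_wordLength_of_mem_modTwoSeries b _ n (Subgroup.mem_iInf.1 hn _) hne)

theorem exists_wallMap [Fintype ι] (b : FreeGroupBasis ι G) (k : ℕ) :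
    ∃ (n : Type (max u v)) (_ : Fintype n) (F : G ⧸ modTwoSeries G k → EuclideanSpace ℂ n)
      (D : G ⧸ modTwoSeries G k → G ⧸ modTwoSeries G k → ℕ),
      (∀ x y, nndist (F x) (F y) = NNReal.sqrt (D x y)) ∧
      (∀ x y, (D x y : ℝ≥0) ≤ quotientDist (fun g => (wordLength (Set.range b) g : ℝ≥0))
        (modTwoSeries G k) x y) ∧
      (∀ x y, D x y < k → quotientDist (fun g => (wordLength (Set.range b) g : ℝ≥0))
        (modTwoSeries G k) x y ≤ D x y) := by
  classical
  cases k with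
  | zero =>
    -- At stage `0` there is no cover to take walls from, but the quotient is a point.
    have : Subsingleton (G ⧸ modTwoSeries G 0) := QuotientGroup.subsingleton_quotient_top
    refine ⟨PEmpty, inferInstance, fun _ => 0, fun _ _ => 0, by simp, by simp, by simp⟩
  | succ k =>
    have := finiteIndex_modTwoSeries b k
    have : Finite (G ⧸ modTwoSeries G k) := Subgroup.finite_quotient_of_finiteIndex
    cases nonempty_fintype (G ⧸ modTwoSeries G k)
    have hch : (modTwoKernel (modTwoSeries G k)).Characteristic := inferInstance
    exact ⟨_, inferInstance, fun x => wallMap b (modTwoSeries G k) x.out, _,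
      fun x y => nndist_wallMap b _ x.out y.out,
      fun x y => hammingDist_chain_out_le x y,
      fun x y h => quotientDist_le_hammingDist (lt_wordLength_of_mem_modTwoSeries b k)
        (Nat.lt_succ_iff.1 h)⟩

end Series

/-! ### The uniform embedding of the whole family. -/

theorem mainTheorem7 (𝔽 : ℕ → Type u) [∀ ω, Group (𝔽 ω)]
    (b : ∀ ω : ℕ, FreeGroupBasis (Fin ω) (𝔽 ω)) :
    ∃ (N : ∀ ω : ℕ, ℕ → Subgroup (𝔽 ω)) (_ : ∀ ω k, (N ω k).Characteristic),
      (∀ ω k, (N ω k).FiniteIndex) ∧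
      (∀ ω, ⨅ k, N ω k = ⊥) ∧
      (∀ ω k, N ω (k + 1) ≤ N ω k ∧ ((N ω (k + 1)).subgroupOf (N ω k)).Characteristic) ∧
      UniformlyEmbedsIntoHilbert (ι := {p : ℕ × ℕ // p.1 ≤ p.2})
        (fun p => 𝔽 p.1.1 ⧸ N p.1.1 p.1.2)
        (fun p => quotientDist (fun g => (wordLength (Set.range (b p.1.1)) g : ℝ≥0))
          (N p.1.1 p.1.2)) := by
  classical
  refine ⟨fun ω k => modTwoSeries (𝔽 ω) k, fun ω k => inferInstance,
    fun ω k => finiteIndex_modTwoSeries (b ω) k, fun ω => iInf_modTwoSeries (b ω),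
    fun ω k => ⟨modTwoKernel_le _, characteristic_modTwoKernel_subgroupOf _⟩, ?_⟩
  choose n hn F D hF hD hd using
    fun p : {p : ℕ × ℕ // p.1 ≤ p.2} => exists_wallMap (b p.1.1) p.1.2
  refine UniformlyEmbedsIntoHilbert.of_forall_exists
    (H := lp (fun p => EuclideanSpace ℂ (n p)) 2) (fun p x => lp.single 2 p (F p x))
    NNReal.sqrt NNReal.sqrt.monotone (NNReal.sqrt.tendsto_atTop) ?_ ?_
  · intro p x y
    rw [(lp.isometry_single p).nndist_eq, hF]
    exact NNReal.sqrt_le_sqrt.2 (hD p x y)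
  · intro R
    -- Image distance below `R` means wall distance below `R ^ 2 ≤ k`. From stage `k` on, this
    -- bounds the word distance by `k`; the earlier stages are finitely many finite spaces with a
    -- common diameter bound `C`, and `C + 1` makes the inequality strict.
    obtain ⟨k, hk⟩ := exists_nat_ge (R ^ 2)
    have hfin : Finite {p : {p : ℕ × ℕ // p.1 ≤ p.2} // p.1.2 < k} := by
      refine Finite.of_injective
        (fun p => (⟨⟨p.1.1.1, p.1.2.trans_lt p.2⟩, ⟨p.1.1.2, p.2⟩⟩ : Fin k × Fin k)) ?_
      rintro ⟨⟨⟨p, q⟩, h⟩, h'⟩ ⟨⟨⟨r, s⟩, h⟩, h'⟩ heq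
      simpa using heq
    have hq : ∀ p : {p : ℕ × ℕ // p.1 ≤ p.2}, Finite (𝔽 p.1.1 ⧸ modTwoSeries (𝔽 p.1.1) p.1.2) :=
      fun p =>
        have := finiteIndex_modTwoSeries (b p.1.1) p.1.2
        Subgroup.finite_quotient_of_finiteIndex
    obtain ⟨C, hC⟩ := (Set.finite_range
      fun z : (p : {p : {p : ℕ × ℕ // p.1 ≤ p.2} // p.1.2 < k}) ×
        (𝔽 p.1.1.1 ⧸ modTwoSeries (𝔽 p.1.1.1) p.1.1.2) ×
        (𝔽 p.1.1.1 ⧸ modTwoSeries (𝔽 p.1.1.1) p.1.1.2) =>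
      quotientDist (fun g => (wordLength (Set.range (b z.1.1.1.1)) g : ℝ≥0))
        (modTwoSeries (𝔽 z.1.1.1.1) z.1.1.1.2) z.2.1 z.2.2).bddAbove
    refine ⟨max k (C + 1), fun p x y h => ?_⟩
    rw [(lp.isometry_single p).nndist_eq, hF] at h
    rcases lt_or_ge p.1.2 k with hp | hp
    · exact ((hC ⟨⟨⟨p, hp⟩, x, y⟩, rfl⟩).trans_lt (lt_add_one C)).trans_le (le_max_right _ _)
    · have hDk : D p x y < k := by
        have : (D p x y : ℝ≥0) < R ^ 2 := by
          rwa [← NNReal.sqrt_lt_sqrt, NNReal.sqrt_sq]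
        exact_mod_cast this.trans_le hk
      exact ((hd p x y (hDk.trans_le hp)).trans_lt (Nat.cast_lt.2 hDk)).trans_le
        (le_max_left _ _)
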